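/- Let $n \ge 2$. Write $e_i$ for the $i$-th unit vector of $\mathbb{Z}^n$. A nonempty set $S \subseteq \mathbb{Z}^n$ is called M$^\natural$-convex if for all $x, y \in S$ and every $i \in \{1,\ldots,n\}$ with $x_i > y_i$, at least one of the following holds: (i) $x - e_i \in S$ and $y + e_i \in S$; (ii) there exists $j \in \{1,\ldots,n\}$ such that $x_j < y_j$, $x - e_i + e_j \in S$ and $y + e_i - e_j \in S$. Let $S_1, \ldots, S_m \subseteq \mathbb{Z}^n$ be M$^\natural$-convex sets, and let $W = S_1 + \cdots + S_m = \{ s_1 + \cdots + s_m \mid s_k \in S_k \}$ be their Minkowski sum. Then for every $x$ in the convex hull of $W$ in $\mathbb{R}^n$ there exists $z \in W$ such that $$\| x - z \|_\infty \le 1 - \frac{1}{n}.$$ -/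

import Mathlib

open scoped Pointwise BigOperators

/-- A set `S ⊆ ℤⁿ` is M♮-convex if it is nonempty and satisfies the exchange property below.
Here `Pi.single i 1` is the `i`-th unit vector. -/
def IsMNatConvex {n : ℕ} (S : Set (Fin n → ℤ)) : Prop :=
  S.Nonempty ∧
    ∀ x ∈ S, ∀ y ∈ S, ∀ i : Fin n, y i < x i →
      (x - Pi.single i 1 ∈ S ∧ y + Pi.single i 1 ∈ S) ∨
      ∃ j : Fin n, x j < y j ∧
        x - Pi.single i 1 + Pi.single j 1 ∈ S ∧ y + Pi.single i 1 - Pi.single j 1 ∈ S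

/-- The inclusion of the integer lattice `ℤⁿ` in `ℝⁿ`. -/
def latticeToReal {n : ℕ} (z : Fin n → ℤ) : Fin n → ℝ := fun i => (z i : ℝ)

/-! The one-sided exchange property, for `W` and for `-W`, survives Minkowski sums. For such `W` a
Hall-type criterion holds: a box `[l, u]` with `l ≤ u` meets `W` if for each `A` some point of `W`
has `A`-sum at most `u(A)` and some point has `A`-sum at least `l(A)`. The bounds are imposed one
coordinate at a time (`BoxCondition.inter_le`). For `x` in the hull, take the integer box within `1
- 1/n` of `x`. Since `u k > x k - 1/n`, we get `u(A) > x(A) - 1`, while some `w ∈ W` has `w(A) ≤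
x(A)`; integrality gives `w(A) ≤ u(A)`. The lower bounds are symmetric. -/

/-- One-sided exchange: whenever `x i` exceeds `y i`, the point `x` can be moved one step in the
direction `-eᵢ` or `-eᵢ + eⱼ`, staying in `W` and approaching `y`. -/
def DownExchange {n : ℕ} (W : Set (Fin n → ℤ)) : Prop :=
  ∀ x ∈ W, ∀ y ∈ W, ∀ i : Fin n, y i < x i →
    x - Pi.single i 1 ∈ W ∨ ∃ j : Fin n, x j < y j ∧ x - Pi.single i 1 + Pi.single j 1 ∈ W

theorem IsMNatConvex.downExchange {n : ℕ} {S : Set (Fin n → ℤ)} (hS : IsMNatConvex S) :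
    DownExchange S := by
  intro x hx y hy i hi
  rcases hS.2 x hx y hy i hi with h | ⟨j, hj, h, -⟩
  · exact Or.inl h.1
  · exact Or.inr ⟨j, hj, h⟩

theorem IsMNatConvex.downExchange_neg {n : ℕ} {S : Set (Fin n → ℤ)} (hS : IsMNatConvex S) :
    DownExchange (-S) := by
  intro x hx y hy i hi
  rw [Set.mem_neg] at hx hy
  rcases hS.2 (-y) hy (-x) hx i (by simpa using hi) with h | ⟨j, hj, -, h⟩
  · left
    rw [Set.mem_neg]
    convert h.2 using 1
    abel
  · refine Or.inr ⟨j, by simpa using hj, ?_⟩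
    rw [Set.mem_neg]
    convert h using 1
    abel

/-- The total excess of `x` over `y`. -/
def excess {n : ℕ} (x y : Fin n → ℤ) : ℕ := ∑ i, (x i - y i).toNat

theorem excess_sub_single_lt {n : ℕ} {x y : Fin n → ℤ} {i : Fin n} (hi : y i < x i) :
    excess (x - Pi.single i 1) y < excess x y := by
  refine Finset.sum_lt_sum (fun k _ => ?_) ⟨i, Finset.mem_univ i, ?_⟩
  · rcases eq_or_ne k i with rfl | hk
    · simp only [Pi.sub_apply, Pi.single_eq_same]; omega
    · simp [hk]
  · simp only [Pi.sub_apply, Pi.single_eq_same]; omega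

theorem excess_add_single_le {n : ℕ} {x y : Fin n → ℤ} {j : Fin n} (hj : x j < y j) :
    excess (x + Pi.single j 1) y ≤ excess x y := by
  refine Finset.sum_le_sum (fun k _ => ?_)
  rcases eq_or_ne k j with rfl | hk
  · simp only [Pi.add_apply, Pi.single_eq_same]; omega
  · simp [hk]

theorem excess_exchange_lt {n : ℕ} {x y : Fin n → ℤ} {i j : Fin n} (hi : y i < x i)
    (hj : x j < y j) : excess (x - Pi.single i 1 + Pi.single j 1) y < excess x y := by
  refine (excess_add_single_le ?_).trans_lt (excess_sub_single_lt hi)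
  have hne : j ≠ i := by rintro rfl; omega
  simpa [hne] using hj

/-- Chains of exchanges in the summands compose to a single exchange in the sum. -/
theorem add_exchange_aux {n : ℕ} {U V : Set (Fin n → ℤ)} (hU : DownExchange U)
    (hV : DownExchange V) {x p q : Fin n → ℤ} (hp : p ∈ U) (hq : q ∈ V) {i : Fin n}
    (hi : (p + q) i < x i) :
    ∀ N : ℕ, ∀ s ∈ U, ∀ t ∈ V, ∀ j : Fin n, excess s p + excess t q = N →
      s + t = x - Pi.single i 1 + Pi.single j 1 →
      x - Pi.single i 1 ∈ U + V ∨
        ∃ j : Fin n, x j < (p + q) j ∧ x - Pi.single i 1 + Pi.single j 1 ∈ U + V := by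
  intro N
  induction N using Nat.strong_induction_on with
  | _ N ih =>
    intro s hs t ht j hN hst
    by_cases hj : x j < (p + q) j
    · exact Or.inr ⟨j, hj, hst ▸ Set.add_mem_add hs ht⟩
    -- If `+eⱼ` is not yet admissible, `s + t` exceeds `p + q` at `j`, so one summand does.
    -- Exchanging there removes `eⱼ` or replaces it by some `eₖ`, and the total excess drops.
    have hgt : (p + q) j < (s + t) j := by
      rw [hst]
      rcases eq_or_ne j i with rfl | hne
      · simpa using hi
      · simp only [Pi.add_apply, Pi.sub_apply, Pi.single_eq_same, Pi.single_eq_of_ne hne] at hj ⊢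
        omega
    simp only [Pi.add_apply] at hgt
    have hx : s + t - Pi.single j 1 = x - Pi.single i 1 := by rw [hst]; abel
    rcases lt_or_ge (p j) (s j) with h | h
    · rcases hU s hs p hp j h with hm | ⟨k, hk, hm⟩
      · left
        rw [← hx, show s + t - Pi.single j 1 = (s - Pi.single j 1) + t by abel]
        exact Set.add_mem_add hm ht
      · have := excess_exchange_lt h hk
        refine ih _ ?_ _ hm t ht k rfl ?_
        · omega
        rw [← hx]; abel
    · have h' : q j < t j := by omega
      rcases hV t ht q hq j h' with hm | ⟨k, hk, hm⟩
      · left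
        rw [← hx, show s + t - Pi.single j 1 = s + (t - Pi.single j 1) by abel]
        exact Set.add_mem_add hs hm
      · have := excess_exchange_lt h' hk
        refine ih _ ?_ s hs _ hm k rfl ?_
        · omega
        rw [← hx]; abel

theorem DownExchange.add {n : ℕ} {U V : Set (Fin n → ℤ)} (hU : DownExchange U)
    (hV : DownExchange V) : DownExchange (U + V) := by
  rintro x ⟨s, hs, t, ht, rfl⟩ y ⟨p, hp, q, hq, rfl⟩ i hi
  -- The chain starts at `x` itself, with `j = i`.
  exact add_exchange_aux hU hV hp hq hi _ s hs t ht i rfl (sub_add_cancel _ _).symm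

theorem downExchange_zero {n : ℕ} : DownExchange (0 : Set (Fin n → ℤ)) := by
  intro x hx y hy i hi
  rw [Set.mem_zero] at hx hy
  subst hx hy
  exact absurd hi (lt_irrefl _)

theorem DownExchange.sum {n m : ℕ} {S : Fin m → Set (Fin n → ℤ)}
    (hS : ∀ k, DownExchange (S k)) : DownExchange (∑ k, S k) :=
  Finset.sum_induction _ _ (fun _ _ => DownExchange.add) downExchange_zero (fun k _ => hS k)

/-! ### Truncation by a coordinate bound -/

/-- Coordinate `i` rises only when `j = i`, and then it stays at most `y i ≤ b`. -/
theorem DownExchange.inter_le {n : ℕ} {W : Set (Fin n → ℤ)} (hW : DownExchange W) (i : Fin n)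
    (b : ℤ) : DownExchange {w ∈ W | w i ≤ b} := by
  rintro x ⟨hx, hxb⟩ y ⟨hy, hyb⟩ k hk
  have hs : (0 : ℤ) ≤ (Pi.single k (1 : ℤ) : Fin n → ℤ) i := by
    rw [Pi.single_apply]; split_ifs <;> norm_num
  rcases hW x hx y hy k hk with h | ⟨j, hj, h⟩
  · refine Or.inl ⟨h, ?_⟩
    simp only [Pi.sub_apply]
    omega
  · refine Or.inr ⟨j, hj, h, ?_⟩
    rcases eq_or_ne i j with rfl | hij
    · simp only [Pi.sub_apply, Pi.add_apply, Pi.single_eq_same]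
      omega
    · simp only [Pi.sub_apply, Pi.add_apply, Pi.single_eq_of_ne hij]
      omega

theorem DownExchange.neg_inter_le {n : ℕ} {W : Set (Fin n → ℤ)} (hW : DownExchange (-W))
    (i : Fin n) (b : ℤ) : DownExchange (-{w ∈ W | w i ≤ b}) := by
  rintro x ⟨hx, hxb⟩ y ⟨hy, hyb⟩ k hk
  simp only [Pi.neg_apply] at hxb hyb
  rcases hW x hx y hy k hk with h | ⟨j, hj, h⟩
  · refine Or.inl ⟨h, ?_⟩
    rcases eq_or_ne i k with rfl | hik
    · simp only [Pi.sub_apply, Pi.neg_apply, Pi.single_eq_same]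
      omega
    · simp only [Pi.sub_apply, Pi.neg_apply, Pi.single_eq_of_ne hik]
      omega
  · refine Or.inr ⟨j, hj, h, ?_⟩
    have hs : (0 : ℤ) ≤ (Pi.single j (1 : ℤ) : Fin n → ℤ) i := by
      rw [Pi.single_apply]; split_ifs <;> norm_num
    rcases eq_or_ne i k with rfl | hik
    · simp only [Pi.sub_apply, Pi.add_apply, Pi.neg_apply, Pi.single_eq_same]
      omega
    · simp only [Pi.sub_apply, Pi.add_apply, Pi.neg_apply, Pi.single_eq_of_ne hik]
      omega

/-! ### Prescribing coordinate sums -/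

theorem sum_single_one {n : ℕ} (B : Finset (Fin n)) (i : Fin n) :
    ∑ k ∈ B, (Pi.single i (1 : ℤ) : Fin n → ℤ) k = if i ∈ B then 1 else 0 := by
  simp [Pi.single_apply]

/-- Moving `r` toward `p`, the sum over `A` can be lowered to any value above that of `p`,
without raising sums over supersets of `A` or lowering sums over sets disjoint from `A`. -/
theorem DownExchange.exists_sum_eq {n : ℕ} {W : Set (Fin n → ℤ)} (hW : DownExchange W)
    {p : Fin n → ℤ} (hp : p ∈ W) (A : Finset (Fin n)) {a : ℤ} (hpa : ∑ k ∈ A, p k ≤ a) :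
    ∀ r ∈ W, a ≤ ∑ k ∈ A, r k → ∃ w ∈ W, ∑ k ∈ A, w k = a ∧
      (∀ B, A ⊆ B → ∑ k ∈ B, w k ≤ ∑ k ∈ B, r k) ∧
      (∀ B, Disjoint A B → ∑ k ∈ B, r k ≤ ∑ k ∈ B, w k) := by
  intro r
  induction hN : excess r p using Nat.strong_induction_on generalizing r with
  | _ N ih =>
  subst hN
  intro hr har
  rcases har.eq_or_lt with h | h
  · exact ⟨r, hr, h.symm, fun _ _ => le_rfl, fun _ _ => le_rfl⟩
  obtain ⟨i, hiA, hi⟩ := Finset.exists_lt_of_sum_lt (hpa.trans_lt h)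
  -- An exchange lowers the `A`-sum by at most one, so the value `a` is never skipped.
  have step : ∀ r' ∈ W, excess r' p < excess r p → ∑ k ∈ A, r k - 1 ≤ ∑ k ∈ A, r' k →
      (∀ B, A ⊆ B → ∑ k ∈ B, r' k ≤ ∑ k ∈ B, r k) →
      (∀ B, Disjoint A B → ∑ k ∈ B, r k ≤ ∑ k ∈ B, r' k) → ∃ w ∈ W, ∑ k ∈ A, w k = a ∧
      (∀ B, A ⊆ B → ∑ k ∈ B, w k ≤ ∑ k ∈ B, r k) ∧
      (∀ B, Disjoint A B → ∑ k ∈ B, r k ≤ ∑ k ∈ B, w k) := by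
    intro r' hr' hlt hA hsup hdis
    obtain ⟨w, hw, hwa, h1, h2⟩ := ih _ hlt r' rfl hr' (by omega)
    exact ⟨w, hw, hwa, fun B hB => (h1 B hB).trans (hsup B hB),
      fun B hB => (hdis B hB).trans (h2 B hB)⟩
  rcases hW r hr p hp i hi with hm | ⟨j, hj, hm⟩
  · refine step _ hm (excess_sub_single_lt hi) ?_ (fun B hB => ?_) (fun B hB => ?_) <;>
      simp only [Pi.sub_apply, Finset.sum_sub_distrib, sum_single_one]
    · simp [hiA]
    · simp [hB hiA]
    · simp [Finset.disjoint_left.mp hB hiA]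
  · refine step _ hm (excess_exchange_lt hi hj) ?_ (fun B hB => ?_) (fun B hB => ?_) <;>
      simp only [Pi.sub_apply, Pi.add_apply, Finset.sum_add_distrib, Finset.sum_sub_distrib,
        sum_single_one]
    · simp only [hiA, if_true]; split_ifs <;> omega
    · simp only [hB hiA, if_true]; split_ifs <;> omega
    · simp only [Finset.disjoint_left.mp hB hiA, if_false]; split_ifs <;> omega

theorem DownExchange.exists_sum_eq_of_neg {n : ℕ} {W : Set (Fin n → ℤ)}
    (hW : DownExchange (-W)) {p : Fin n → ℤ} (hp : p ∈ W) (A : Finset (Fin n)) {a : ℤ}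
    (hpa : a ≤ ∑ k ∈ A, p k) {r : Fin n → ℤ} (hr : r ∈ W) (har : ∑ k ∈ A, r k ≤ a) :
    ∃ w ∈ W, ∑ k ∈ A, w k = a ∧ ∀ B, A ⊆ B → ∑ k ∈ B, r k ≤ ∑ k ∈ B, w k := by
  obtain ⟨w, hw, hwa, h, -⟩ := hW.exists_sum_eq (p := -p) (by simpa using hp) A (a := -a)
    (by simpa using hpa) (-r) (by simpa using hr) (by simpa using har)
  refine ⟨-w, hw, ?_, fun B hB => ?_⟩
  · simp [hwa]
  · have := h B hB
    simp only [Pi.neg_apply, Finset.sum_neg_distrib] at this ⊢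
    omega

/-! ### Hall-type criterion for boxes -/

/-- The exchange properties of `W`, with Hall-type conditions for meeting the box `[l, u]`. -/
structure BoxCondition {n : ℕ} (W : Set (Fin n → ℤ)) (l u : Fin n → ℤ) : Prop where
  down : DownExchange W
  up : DownExchange (-W)
  upper : ∀ A : Finset (Fin n), ∃ w ∈ W, ∑ k ∈ A, w k ≤ ∑ k ∈ A, u k
  lower : ∀ A : Finset (Fin n), ∃ w ∈ W, ∑ k ∈ A, l k ≤ ∑ k ∈ A, w k

theorem BoxCondition.neg {n : ℕ} {W : Set (Fin n → ℤ)} {l u : Fin n → ℤ}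
    (h : BoxCondition W l u) : BoxCondition (-W) (-u) (-l) where
  down := h.up
  up := by simpa using h.down
  upper A := by
    obtain ⟨w, hw, hA⟩ := h.lower A
    exact ⟨-w, by simpa using hw, by simpa using hA⟩
  lower A := by
    obtain ⟨w, hw, hA⟩ := h.upper A
    exact ⟨-w, by simpa using hw, by simpa using hA⟩

/-- A point `r` good for `insert i A` violates at most one of the two bounds. Lowering that sum to
equality does not raise the total, so the other bound follows by subtraction. -/
theorem BoxCondition.exists_upper {n : ℕ} {W : Set (Fin n → ℤ)} {l u : Fin n → ℤ}
    (h : BoxCondition W l u) {i : Fin n} {A : Finset (Fin n)} (hi : i ∉ A) :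
    ∃ w ∈ W, w i ≤ u i ∧ ∑ k ∈ A, w k ≤ ∑ k ∈ A, u k := by
  obtain ⟨p, hp, hpA⟩ := h.upper A
  obtain ⟨q, hq, hqi⟩ := h.upper {i}
  obtain ⟨r, hr, hrA⟩ := h.upper (insert i A)
  rcases lt_or_ge (u i) (r i) with hri | hri
  · obtain ⟨w, hw, hwi, hsup, -⟩ := h.down.exists_sum_eq hq {i} hqi r hr (by simpa using hri.le)
    have := hsup (insert i A) (by simp)
    simp only [Finset.sum_insert hi, Finset.sum_singleton] at *
    exact ⟨w, hw, by omega, by omega⟩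
  rcases lt_or_ge (∑ k ∈ A, u k) (∑ k ∈ A, r k) with hra | hra
  · obtain ⟨w, hw, hwA, hsup, -⟩ := h.down.exists_sum_eq hp A hpA r hr hra.le
    have := hsup (insert i A) (by simp)
    simp only [Finset.sum_insert hi, Finset.sum_singleton] at *
    exact ⟨w, hw, by omega, by omega⟩
  · exact ⟨r, hr, hri, hra⟩

theorem BoxCondition.exists_lower {n : ℕ} {W : Set (Fin n → ℤ)} {l u : Fin n → ℤ}
    (h : BoxCondition W l u) {i : Fin n} {A : Finset (Fin n)} (hi : i ∉ A) :
    ∃ w ∈ W, w i ≤ u i ∧ ∑ k ∈ A, l k ≤ ∑ k ∈ A, w k := by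
  obtain ⟨p, hp, hpA⟩ := h.lower A
  obtain ⟨q, hq, hqi⟩ := h.upper {i}
  rcases lt_or_ge (u i) (p i) with hpi | hpi
  · obtain ⟨w, hw, hwi, -, hdis⟩ := h.down.exists_sum_eq hq {i} hqi p hp (by simpa using hpi.le)
    have := hdis A (by simpa using hi)
    simp only [Finset.sum_singleton] at hwi
    exact ⟨w, hw, hwi.le, hpA.trans this⟩
  · exact ⟨p, hp, hpi, hpA⟩

/-- If the `A`-sum is large enough, coordinate `i` can be lowered to `u i ≥ l i`. Otherwise the
`A`-sum is first raised to `l(A)`, without decreasing the total over `insert i A`. -/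
theorem BoxCondition.exists_lower_insert {n : ℕ} {W : Set (Fin n → ℤ)} {l u : Fin n → ℤ}
    (h : BoxCondition W l u) {i : Fin n} (hlu : l i ≤ u i) {A : Finset (Fin n)} (hi : i ∉ A) :
    ∃ w ∈ W, w i ≤ u i ∧ ∑ k ∈ insert i A, l k ≤ ∑ k ∈ insert i A, w k := by
  obtain ⟨q, hq, hqi, hqA⟩ := h.exists_lower hi
  have key : ∀ r ∈ W, ∑ k ∈ A, l k ≤ ∑ k ∈ A, r k → u i ≤ r i →
      ∃ w ∈ W, w i ≤ u i ∧ ∑ k ∈ insert i A, l k ≤ ∑ k ∈ insert i A, w k := by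
    intro r hr hrA hri
    obtain ⟨w, hw, hwi, -, hdis⟩ :=
      h.down.exists_sum_eq hq {i} (by simpa using hqi) r hr (by simpa using hri)
    have := hdis A (by simpa using hi)
    simp only [Finset.sum_singleton] at hwi
    refine ⟨w, hw, hwi.le, ?_⟩
    simp only [Finset.sum_insert hi]
    omega
  obtain ⟨p, hp, hpA⟩ := h.lower (insert i A)
  rcases le_or_gt (p i) (u i) with hpi | hpi
  · exact ⟨p, hp, hpi, hpA⟩
  rcases le_or_gt (∑ k ∈ A, l k) (∑ k ∈ A, p k) with hA | hA
  · exact key p hp hA hpi.le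
  obtain ⟨r, hr, hrA, hsup⟩ := h.up.exists_sum_eq_of_neg hq A hqA hp hA.le
  rcases le_or_gt (r i) (u i) with hri | hri
  · exact ⟨r, hr, hri, hpA.trans (hsup _ (Finset.subset_insert i A))⟩
  · exact key r hr hrA.ge hri.le

theorem BoxCondition.inter_le {n : ℕ} {W : Set (Fin n → ℤ)} {l u : Fin n → ℤ}
    (h : BoxCondition W l u) {i : Fin n} (hlu : l i ≤ u i) :
    BoxCondition {w ∈ W | w i ≤ u i} l u where
  down := h.down.inter_le i (u i)
  up := h.up.neg_inter_le i (u i)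
  upper A := by
    by_cases hi : i ∈ A
    · obtain ⟨w, hw, hwi, hwA⟩ := h.exists_upper (Finset.notMem_erase i A)
      refine ⟨w, ⟨hw, hwi⟩, ?_⟩
      rw [← Finset.add_sum_erase A w hi, ← Finset.add_sum_erase A u hi]
      omega
    · obtain ⟨w, hw, hwi, hwA⟩ := h.exists_upper hi
      exact ⟨w, ⟨hw, hwi⟩, hwA⟩
  lower A := by
    by_cases hi : i ∈ A
    · obtain ⟨w, hw, hwi, hwA⟩ := h.exists_lower_insert hlu (Finset.notMem_erase i A)
      rw [Finset.insert_erase hi] at hwA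
      exact ⟨w, ⟨hw, hwi⟩, hwA⟩
    · obtain ⟨w, hw, hwi, hwA⟩ := h.exists_lower hi
      exact ⟨w, ⟨hw, hwi⟩, hwA⟩

theorem BoxCondition.inter_forall_le {n : ℕ} {W : Set (Fin n → ℤ)} {l u : Fin n → ℤ}
    (h : BoxCondition W l u) (hlu : l ≤ u) (T : Finset (Fin n)) :
    BoxCondition {w ∈ W | ∀ i ∈ T, w i ≤ u i} l u := by
  induction T using Finset.induction_on with
  | empty => simpa using h
  | insert i T _ ih =>
    convert ih.inter_le (hlu i) using 1
    ext w
    simp only [Finset.forall_mem_insert, Set.mem_ofPred_eq]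
    tauto

theorem BoxCondition.exists_mem_Icc {n : ℕ} {W : Set (Fin n → ℤ)} {l u : Fin n → ℤ}
    (h : BoxCondition W l u) (hlu : l ≤ u) : ∃ w ∈ W, l ≤ w ∧ w ≤ u := by
  -- For `∅` the condition says only that the truncated set is nonempty.
  have h' := ((h.inter_forall_le hlu Finset.univ).neg.inter_forall_le
    (neg_le_neg hlu) Finset.univ).upper ∅
  obtain ⟨w, ⟨⟨hw, hwu⟩, hwl⟩, -⟩ := h'
  refine ⟨-w, hw, fun i => ?_, fun i => hwu i (Finset.mem_univ i)⟩
  have := hwl i (Finset.mem_univ i)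
  simp only [Pi.neg_apply] at this ⊢
  omega

/-! ### Points of the convex hull -/

/-- Summation over the coordinates in `A`, as a linear functional. -/
def coordSum {n : ℕ} (A : Finset (Fin n)) : (Fin n → ℝ) →ₗ[ℝ] ℝ :=
  ∑ k ∈ A, LinearMap.proj k

theorem coordSum_apply {n : ℕ} (A : Finset (Fin n)) (x : Fin n → ℝ) :
    coordSum A x = ∑ k ∈ A, x k := by
  simp [coordSum]

theorem exists_sum_le_of_mem_convexHull {n : ℕ} {W : Set (Fin n → ℤ)} {x : Fin n → ℝ}
    (hx : x ∈ convexHull ℝ (latticeToReal '' W)) (A : Finset (Fin n)) :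
    ∃ w ∈ W, ((∑ k ∈ A, w k : ℤ) : ℝ) ≤ ∑ k ∈ A, x k := by
  obtain ⟨_, ⟨w, hw, rfl⟩, h⟩ :=
    ((coordSum A).concaveOn convex_univ).exists_le_of_mem_convexHull (Set.subset_univ _) hx
  refine ⟨w, hw, ?_⟩
  simpa [coordSum_apply, latticeToReal] using h

theorem exists_le_sum_of_mem_convexHull {n : ℕ} {W : Set (Fin n → ℤ)} {x : Fin n → ℝ}
    (hx : x ∈ convexHull ℝ (latticeToReal '' W)) (A : Finset (Fin n)) :
    ∃ w ∈ W, ∑ k ∈ A, x k ≤ ((∑ k ∈ A, w k : ℤ) : ℝ) := by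
  obtain ⟨_, ⟨w, hw, rfl⟩, h⟩ :=
    ((coordSum A).convexOn convex_univ).exists_ge_of_mem_convexHull (Set.subset_univ _) hx
  refine ⟨w, hw, ?_⟩
  simpa [coordSum_apply, latticeToReal] using h

theorem card_mul_inv_le_one {n : ℕ} (A : Finset (Fin n)) : (A.card : ℝ) * (1 / n) ≤ 1 := by
  have h : (A.card : ℝ) ≤ n := by exact_mod_cast card_finset_fin_le A
  rw [mul_one_div]
  exact div_le_one_of_le₀ h (Nat.cast_nonneg n)

theorem boxCondition_of_mem_convexHull {n : ℕ} {W : Set (Fin n → ℤ)} (hd : DownExchange W)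
    (hu : DownExchange (-W)) {x : Fin n → ℝ} (hx : x ∈ convexHull ℝ (latticeToReal '' W)) :
    BoxCondition W (fun i => ⌈x i - (1 - 1 / (n : ℝ))⌉) (fun i => ⌊x i + (1 - 1 / (n : ℝ))⌋) where
  down := hd
  up := hu
  upper A := by
    obtain ⟨w, hw, h⟩ := exists_sum_le_of_mem_convexHull hx A
    refine ⟨w, hw, ?_⟩
    rcases A.eq_empty_or_nonempty with rfl | hA
    · simp
    have hlt : ∑ k ∈ A, (x k - 1 / (n : ℝ)) < ∑ k ∈ A, (⌊x k + (1 - 1 / (n : ℝ))⌋ : ℝ) :=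
      Finset.sum_lt_sum_of_nonempty hA fun k _ => by
        linarith [Int.lt_floor_add_one (x k + (1 - 1 / (n : ℝ)))]
    rw [Finset.sum_sub_distrib, Finset.sum_const, nsmul_eq_mul] at hlt
    have := card_mul_inv_le_one A
    rw [← Int.lt_add_one_iff, ← Int.cast_lt (R := ℝ)]
    push_cast at h ⊢
    linarith
  lower A := by
    obtain ⟨w, hw, h⟩ := exists_le_sum_of_mem_convexHull hx A
    refine ⟨w, hw, ?_⟩
    rcases A.eq_empty_or_nonempty with rfl | hA
    · simp
    have hlt : ∑ k ∈ A, (⌈x k - (1 - 1 / (n : ℝ))⌉ : ℝ) < ∑ k ∈ A, (x k + 1 / (n : ℝ)) :=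
      Finset.sum_lt_sum_of_nonempty hA fun k _ => by
        linarith [Int.ceil_lt_add_one (x k - (1 - 1 / (n : ℝ)))]
    rw [Finset.sum_add_distrib, Finset.sum_const, nsmul_eq_mul] at hlt
    have := card_mul_inv_le_one A
    rw [← Int.lt_add_one_iff, ← Int.cast_lt (R := ℝ)]
    push_cast at h ⊢
    linarith

/-- `∑ k, S k` is the Minkowski sum of the sets `S k`, and `‖·‖` on `Fin n → ℝ` is the
maximum norm. -/
theorem mainTheorem3 (n m : ℕ) (hn : 2 ≤ n) (S : Fin m → Set (Fin n → ℤ))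
    (hS : ∀ k, IsMNatConvex (S k)) (x : Fin n → ℝ)
    (hx : x ∈ convexHull ℝ (latticeToReal '' (∑ k, S k))) :
    ∃ z ∈ ∑ k, S k, ‖x - latticeToReal z‖ ≤ 1 - 1 / (n : ℝ) := by
  have hd : DownExchange (∑ k, S k) := DownExchange.sum fun k => (hS k).downExchange
  have hu : DownExchange (-∑ k, S k) := by
    have hneg : -∑ k, S k = ∑ k, -S k := by
      induction (Finset.univ : Finset (Fin m)) using Finset.induction_on with
      | empty => simp
      | insert k T hk ih => rw [Finset.sum_insert hk, Finset.sum_insert hk, neg_add, ih]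
    rw [hneg]
    exact DownExchange.sum fun k => (hS k).downExchange_neg
  have hn' : 1 / (n : ℝ) ≤ 1 / 2 := by
    have : (2 : ℝ) ≤ n := by exact_mod_cast hn
    exact one_div_le_one_div_of_le (by norm_num) this
  -- Each interval has length `2 - 2/n ≥ 1`, so it contains an integer.
  obtain ⟨z, hz, hl, hr⟩ := (boxCondition_of_mem_convexHull hd hu hx).exists_mem_Icc fun i => by
    rw [Int.le_floor]
    linarith [Int.ceil_lt_add_one (x i - (1 - 1 / (n : ℝ)))]
  refine ⟨z, hz, (pi_norm_le_iff_of_nonneg (by linarith)).2 fun i => ?_⟩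
  have h1 := Int.ceil_le.1 (hl i)
  have h2 := Int.le_floor.1 (hr i)
  rw [Real.norm_eq_abs, abs_le]
  simp only [Pi.sub_apply, latticeToReal]
  constructor <;> linarith
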